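/- **Notation.** Let $\mu\in[0,1)\cup i(0,\infty)$. For integers $n\ge m\ge 0$ let $P_n^m$ be the associated Legendre functions of the first kind: $P_n^m(t)=(-1)^m(1-t^2)^{m/2}\frac{d^m}{dt^m}P_n(t)$ for $-1\le t\le 1$, and $P_n^m(\cosh v)=(\sinh v)^m P_n^{(m)}(\cosh v)$ off the cut, $P_n$ being the Legendre polynomial. Write $(a)_j=a(a+1)\cdots(a+j-1)$, $(a)_0=1$. For $x=(x_0,x_1,x_2)\in\mathbb R^3$ write $x_1=\rho\cos\phi$, $x_2=\rho\sin\phi$ with $\rho\ge0$, and for $\mu\ne0$ use spheroidal coordinates $x_0=\mu\cos u\cosh v$, $\rho=\mu\sin u\sinh v$ with $0\le u\le\pi$, where $v\ge 0$ if $\mu>0$, and $v=w-i\pi/2$ with $w\ge0$ if $\mu\in i(0,\infty)$. Put $$U_{n,m}[\mu]=\frac{(n-m)!}{2^n(1/2)_n}\,\mu^n P_n^m(\cos u)P_n^m(\cosh v)\quad(\mu\neq0),\qquad U_{n,m}[0]=|x|^nP_n^m(x_0/|x|),$$ and $U_{n,m}^{\pm}[\mu](x)=U_{n,m}[\mu]\,\Phi_m^\pm(\phi)$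 with $\Phi_m^+(\phi)=\cos(m\phi)$, $\Phi_m^-(\phi)=\sin(m\phi)$ (at the origin $U_{0,0}[0]=1$ and $U_{n,m}[0]=0$ for $n\ge1$). The Garabedian spheroidal harmonics are $$V_{n,m}^{\pm}[\mu]=\frac{\partial}{\partial x_0}U_{n+1,m}^{\pm}[\mu],$$ and $V_{n,m}[\mu]$ is the factor, depending on $(x_0,\rho)$ only, with $V_{n,m}^\pm[\mu](x)=V_{n,m}[\mu]\,\Phi_m^\pm(\phi)$, that is, $V_{n,m}[\mu]=\partial U_{n+1,m}[\mu]/\partial x_0$. **Proposition.** Let $n\ge0$, $0\le m\le n$ and $\mu\in[0,1)\cup i(0,\infty)$. Then the derivatives defining the functions $V_{n-2k,m}^\pm[\mu]$, $0\le 2k\le n-m$, exist at every point of $\mathbb R^3$, and $$U_{n,m}[0]=\sum_{0\le 2k\le n-m}u^0_{n,m,k}\,\mu^{2k}\,V_{n-2k,m}[\mu]$$ at all points $(x_0,\rho)$ with $x_0\in\mathbb R$, $\rho\ge0$; equivalently, for both signs and at every $x\in\mathbb R^3$, $$U_{n,m}^{\pm}[0](x)=\sum_{0\le 2k\le n-m}u^0_{n,m,k}\,\mu^{2k}\,V_{n-2k,m}^{\pm}[\mu](x),$$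 with the rational coefficients, independent of $\mu$, $$u^0_{n,m,k}=\frac{u^0_{n+1,m,k}(U)}{n+m+1},\qquad u^0_{n,m,k}(U)=\frac{4^{n-2k}(2n-4k+1)\,(n-k)!\,(m+n)!\,(1/2)_{n-2k}}{k!\,(2n-2k+1)!\,(n+m-2k)!}.$$ (For $\mu=0$ one reads $0^0=1$.) -/

import Mathlib

/-- The admissible parameters `μ = (1 - e^{2ν})^{1/2}`, `ν ∈ ℝ`, that is `μ ∈ [0, 1) ∪ i (0, ∞)`:
real and positive for prolate spheroids, zero for the ball, imaginary for oblate spheroids. -/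
def spheroidalParams : Set ℂ :=
  {μ | (∃ t : ℝ, 0 ≤ t ∧ t < 1 ∧ μ = (t : ℂ)) ∨ (∃ t : ℝ, 0 < t ∧ μ = (t : ℂ) * Complex.I)}

/-- The Legendre polynomial `P_n` (Rodrigues' formula). -/
noncomputable def legendrePoly (n : ℕ) : Polynomial ℂ :=
  Polynomial.C (1 / (2 ^ n * (n.factorial : ℂ))) *
    (Polynomial.derivative^[n] ((Polynomial.X ^ 2 - 1) ^ n))

/-- The associated Legendre function of the first kind on the cut `-1 ≤ t ≤ 1`:
`P_n^m(t) = (-1)^m (1 - t^2)^{m/2} (d/dt)^m P_n(t)`. -/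
noncomputable def assocLegendreCut (n m : ℕ) (t : ℝ) : ℂ :=
  (-1) ^ m * ((Real.sqrt (1 - t ^ 2) : ℝ) : ℂ) ^ m *
    (Polynomial.derivative^[m] (legendrePoly n)).eval (t : ℂ)

/-- The associated Legendre function of the first kind off the cut,
`P_n^m(z) = (z^2 - 1)^{m/2} (d/dz)^m P_n(z)`, at the point `z = cosh v`,
where the branch of the root is `(z^2 - 1)^{1/2} = sinh v`. -/
noncomputable def assocLegendreCosh (n m : ℕ) (v : ℂ) : ℂ :=
  Complex.sinh v ^ m * (Polynomial.derivative^[m] (legendrePoly n)).eval (Complex.cosh v)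

/-- `(u, v)` are spheroidal coordinates, for the parameter `μ ≠ 0`, of the points
`(x₀, ρ cos φ, ρ sin φ)`: `x₀ = μ cos u cosh v` and `ρ = μ sin u sinh v`, with `0 ≤ u ≤ π`.
In the prolate case (`μ` real) `v` is a real number `≥ 0`; in the oblate case (`μ` imaginary)
`v = w - iπ/2` with `w ≥ 0` real, so that for `μ = ic` the equations read
`x₀ = c cos u sinh w`, `ρ = c sin u cosh w`. -/
def IsSpheroidalCoord (μ : ℂ) (x₀ ρ u : ℝ) (v : ℂ) : Prop :=
  0 ≤ u ∧ u ≤ Real.pi ∧ 0 ≤ v.re ∧ ((μ.im = 0 ∧ v.im = 0) ∨ (0 < μ.im ∧ v.im = -(Real.pi / 2))) ∧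
    (x₀ : ℂ) = μ * Complex.cos u * Complex.cosh v ∧ (ρ : ℂ) = μ * Complex.sin u * Complex.sinh v

/-- The product `U_{n,m}[μ](u,v) = ((n-m)! / (2^n (1/2)_n)) μ^n P_n^m(cos u) P_n^m(cosh v)`,
for `μ ≠ 0`. -/
noncomputable def spheroidalProduct (μ : ℂ) (n m : ℕ) (u : ℝ) (v : ℂ) : ℂ :=
  ((n - m).factorial : ℂ) / (2 ^ n * (ascPochhammer ℂ n).eval (1 / 2)) * μ ^ n *
    assocLegendreCut n m (Real.cos u) * assocLegendreCosh n m v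

open Classical in
/-- The meridional factor `U_{n,m}[μ]`, as a function of `x₀` and `ρ = (x₁² + x₂²)^{1/2}`.
For `μ = 0` it is `|x|^n P_n^m(x₀ / |x|)`; for `μ ≠ 0` it is the product above at spheroidal
coordinates of `(x₀, ρ)`, which exist for all `ρ ≥ 0`; the value does not depend on their choice
(both facts are proved below). -/
noncomputable def meridionalU (μ : ℂ) (n m : ℕ) (x₀ ρ : ℝ) : ℂ :=
  if μ = 0 then
    ((Real.sqrt (x₀ ^ 2 + ρ ^ 2) : ℝ) : ℂ) ^ n *
      assocLegendreCut n m (x₀ / Real.sqrt (x₀ ^ 2 + ρ ^ 2))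
  else if h : ∃ p : ℝ × ℂ, IsSpheroidalCoord μ x₀ ρ p.1 p.2 then
    spheroidalProduct μ n m h.choose.1 h.choose.2
  else 0

/-- The sign in the superscript of a solid harmonic. -/
inductive HarmonicSign
  | plus
  | minus

/-- `Φ_m^+(φ) = cos (m φ)`, `Φ_m^-(φ) = sin (m φ)`. -/
noncomputable def angularFactor : HarmonicSign → ℕ → ℝ → ℝ
  | HarmonicSign.plus, m, φ => Real.cos (m * φ)
  | HarmonicSign.minus, m, φ => Real.sin (m * φ)

/-- The distance of `x = (x₀, x₁, x₂)` to the `x₀`-axis. -/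
noncomputable def axialRadius (x : EuclideanSpace ℝ (Fin 3)) : ℝ :=
  Real.sqrt (x 1 ^ 2 + x 2 ^ 2)

/-- The azimuth `φ`: `x₁ = ρ cos φ`, `x₂ = ρ sin φ`. -/
noncomputable def azimuth (x : EuclideanSpace ℝ (Fin 3)) : ℝ :=
  Complex.arg ⟨x 1, x 2⟩

/-- The solid spheroidal harmonic `U_{n,m}^±[μ](x) = U_{n,m}[μ] Φ_m^±(φ)`
(the classical solid spherical harmonic for `μ = 0`). -/
noncomputable def solidU (μ : ℂ) (n m : ℕ) (s : HarmonicSign) (x : EuclideanSpace ℝ (Fin 3)) : ℂ :=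
  meridionalU μ n m (x 0) (axialRadius x) * (angularFactor s m (azimuth x) : ℂ)

/-- The Garabedian spheroidal harmonic `V_{n,m}^±[μ] = ∂ U_{n+1,m}^±[μ] / ∂x₀`. -/
noncomputable def solidV (μ : ℂ) (n m : ℕ) (s : HarmonicSign) (x : EuclideanSpace ℝ (Fin 3)) : ℂ :=
  lineDeriv ℝ (solidU μ (n + 1) m s) x (EuclideanSpace.single 0 1)

/-- The meridional factor `V_{n,m}[μ]`, with `V_{n,m}^±[μ](x) = V_{n,m}[μ] Φ_m^±(φ)`
(proved below), as a function of `x₀` and `ρ`. -/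
noncomputable def meridionalV (μ : ℂ) (n m : ℕ) (x₀ ρ : ℝ) : ℂ :=
  deriv (fun t : ℝ => meridionalU μ (n + 1) m t ρ) x₀

/-- The rational constants
`u⁰_{n,m,k}(U) = 4^{n-2k} (2n-4k+1) (n-k)! (m+n)! (1/2)_{n-2k} / (k! (2n-2k+1)! (n+m-2k)!)`,
for `2k ≤ n`. -/
noncomputable def coeffUU (n m k : ℕ) : ℚ :=
  4 ^ (n - 2 * k) * (2 * (n : ℚ) - 4 * (k : ℚ) + 1) * ((n - k).factorial : ℚ) *
      ((m + n).factorial : ℚ) * (ascPochhammer ℚ (n - 2 * k)).eval (1 / 2) /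
    ((k.factorial : ℚ) * ((2 * n - 2 * k + 1).factorial : ℚ) * ((n + m - 2 * k).factorial : ℚ))

/-- The rational constants `u⁰_{n,m,k} = u⁰_{n+1,m,k}(U) / (n + m + 1)`. -/
noncomputable def coeffUV (n m k : ℕ) : ℚ :=
  coeffUU (n + 1) m k / ((n : ℚ) + (m : ℚ) + 1)

theorem solidV_eq (μ : ℂ) (n m : ℕ) (s : HarmonicSign) (x : EuclideanSpace ℝ (Fin 3)) :
    solidV μ n m s x =
      meridionalV μ n m (x 0) (axialRadius x) * (angularFactor s m (azimuth x) : ℂ) := by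
  have h : (fun t : ℝ => solidU μ (n + 1) m s (x + t • EuclideanSpace.single 0 1)) =
      fun t : ℝ => (fun r : ℝ => meridionalU μ (n + 1) m r (axialRadius x)) (x 0 + t) *
        (angularFactor s m (azimuth x) : ℂ) := by
    funext t
    simp [solidU, axialRadius, azimuth]
  unfold solidV lineDeriv meridionalV
  rw [h, deriv_mul_const_field,
    deriv_comp_const_add (fun r : ℝ => meridionalU μ (n + 1) m r (axialRadius x)) (x 0) 0,
    add_zero]

theorem cosh_oblate (w : ℝ) :
    Complex.cosh ((w : ℂ) - (Real.pi / 2 : ℝ) * Complex.I) = -(Complex.I * (Real.sinh w : ℝ)) := by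
  rw [Complex.cosh_sub, Complex.cosh_mul_I, Complex.sinh_mul_I, ← Complex.ofReal_cos,
    ← Complex.ofReal_sin, Real.cos_pi_div_two, Real.sin_pi_div_two, Complex.ofReal_sinh]
  simp [mul_comm]

theorem sinh_oblate (w : ℝ) :
    Complex.sinh ((w : ℂ) - (Real.pi / 2 : ℝ) * Complex.I) = -(Complex.I * (Real.cosh w : ℝ)) := by
  rw [Complex.sinh_sub, Complex.cosh_mul_I, Complex.sinh_mul_I, ← Complex.ofReal_cos,
    ← Complex.ofReal_sin, Real.cos_pi_div_two, Real.sin_pi_div_two, Complex.ofReal_cosh]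
  simp [mul_comm]

/-- Spheroidal coordinates in the prolate case, in real terms. -/
theorem isSpheroidalCoord_prolate {t x₀ ρ u : ℝ} {v : ℂ} :
    IsSpheroidalCoord (t : ℂ) x₀ ρ u v ↔
      0 ≤ u ∧ u ≤ Real.pi ∧ ∃ w : ℝ, 0 ≤ w ∧ v = (w : ℂ) ∧
        x₀ = t * Real.cos u * Real.cosh w ∧ ρ = t * Real.sin u * Real.sinh w := by
  unfold IsSpheroidalCoord
  constructor
  · rintro ⟨h1, h2, h3, h4, h5, h6⟩
    have hv : v = ((v.re : ℝ) : ℂ) := by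
      rcases h4 with h4 | h4
      · exact Complex.ext (by simp) (by simp [h4.2])
      · exact absurd h4.1 (by simp)
    refine ⟨h1, h2, v.re, h3, hv, ?_, ?_⟩
    · rw [hv] at h5
      exact_mod_cast h5
    · rw [hv] at h6
      exact_mod_cast h6
  · rintro ⟨h1, h2, w, h3, rfl, h5, h6⟩
    refine ⟨h1, h2, by simpa using h3, Or.inl (by simp), ?_, ?_⟩
    · rw [h5]
      push_cast
      ring
    · rw [h6]
      push_cast
      ring

/-- Spheroidal coordinates in the oblate case, in real terms. -/
theorem isSpheroidalCoord_oblate {c x₀ ρ u : ℝ} {v : ℂ} (hc : 0 < c) :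
    IsSpheroidalCoord ((c : ℂ) * Complex.I) x₀ ρ u v ↔
      0 ≤ u ∧ u ≤ Real.pi ∧ ∃ w : ℝ, 0 ≤ w ∧ v = (w : ℂ) - (Real.pi / 2 : ℝ) * Complex.I ∧
        x₀ = c * Real.cos u * Real.sinh w ∧ ρ = c * Real.sin u * Real.cosh w := by
  have e1 : ∀ a b : ℝ, (c : ℂ) * Complex.I * (a : ℂ) * -(Complex.I * (b : ℂ)) =
      ((c * a * b : ℝ) : ℂ) := by
    intro a b
    push_cast
    linear_combination (-(c : ℂ) * a * b) * Complex.I_mul_I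
  unfold IsSpheroidalCoord
  constructor
  · rintro ⟨h1, h2, h3, h4, h5, h6⟩
    have hv : v = (v.re : ℂ) - (Real.pi / 2 : ℝ) * Complex.I := by
      rcases h4 with h4 | h4
      · exact absurd h4.1 (by simp [hc.ne'])
      · exact Complex.ext (by simp) (by rw [h4.2]; simp)
    refine ⟨h1, h2, v.re, h3, hv, ?_, ?_⟩
    · rw [hv, cosh_oblate, ← Complex.ofReal_cos, e1] at h5
      exact_mod_cast h5
    · rw [hv, sinh_oblate, ← Complex.ofReal_sin, e1] at h6
      exact_mod_cast h6
  · rintro ⟨h1, h2, w, h3, rfl, h5, h6⟩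
    refine ⟨h1, h2, by simpa using h3, Or.inr (by simpa using hc), ?_, ?_⟩
    · rw [cosh_oblate, ← Complex.ofReal_cos, e1, h5]
    · rw [sinh_oblate, ← Complex.ofReal_sin, e1, h6]

theorem exists_isSpheroidalCoord {μ : ℂ} (hμ : μ ∈ spheroidalParams) (h0 : μ ≠ 0)
    (x₀ : ℝ) {ρ : ℝ} (hρ : 0 ≤ ρ) : ∃ p : ℝ × ℂ, IsSpheroidalCoord μ x₀ ρ p.1 p.2 := by
  rcases hμ with ⟨t, ht0, -, rfl⟩ | ⟨c, hc, rfl⟩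
  · have ht : 0 < t := lt_of_le_of_ne ht0 fun h => h0 (by simp [← h])
    set p := Real.sqrt ((x₀ + t) ^ 2 + ρ ^ 2) with hp
    set q := Real.sqrt ((x₀ - t) ^ 2 + ρ ^ 2) with hq
    have hp2 : p ^ 2 = (x₀ + t) ^ 2 + ρ ^ 2 := Real.sq_sqrt (by positivity)
    have hq2 : q ^ 2 = (x₀ - t) ^ 2 + ρ ^ 2 := Real.sq_sqrt (by positivity)
    have hp1 : |x₀ + t| ≤ p := Real.abs_le_sqrt (by nlinarith)
    have hq1 : |x₀ - t| ≤ q := Real.abs_le_sqrt (by nlinarith)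
    rw [abs_le] at hp1 hq1
    have hp0 : 0 ≤ p := Real.sqrt_nonneg _
    have hq0 : 0 ≤ q := Real.sqrt_nonneg _
    obtain ⟨a, ha⟩ : ∃ a, a = (p + q) / (2 * t) := ⟨_, rfl⟩
    obtain ⟨b, hb⟩ : ∃ b, b = (p - q) / (2 * t) := ⟨_, rfl⟩
    have ha1 : 1 ≤ a := by
      rw [ha, le_div_iff₀ (by positivity)]
      linarith
    have hab : x₀ = t * b * a := by
      rw [ha, hb]
      field_simp
      nlinarith
    have hs : a ^ 2 + b ^ 2 = 1 + (x₀ ^ 2 + ρ ^ 2) / t ^ 2 := by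
      rw [ha, hb]
      field_simp
      nlinarith
    have hpr : (1 - b ^ 2) * (a ^ 2 - 1) = (ρ / t) ^ 2 := by
      have : x₀ ^ 2 / t ^ 2 = b ^ 2 * a ^ 2 := by
        rw [hab]
        field_simp
      rw [add_div, this] at hs
      rw [div_pow]
      linarith
    have hb1 : b ^ 2 ≤ 1 := by
      have h1 : (p - q) ^ 2 ≤ (2 * t) ^ 2 := by
        have : p ^ 2 * q ^ 2 = (x₀ ^ 2 + ρ ^ 2 - t ^ 2) ^ 2 + (2 * t * ρ) ^ 2 := by
          rw [hp2, hq2]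
          ring
        have : x₀ ^ 2 + ρ ^ 2 - t ^ 2 ≤ p * q := by
          apply le_of_sq_le_sq _ (by positivity)
          nlinarith [sq_nonneg (t * ρ)]
        nlinarith
      rw [hb, div_pow, div_le_one (by positivity)]
      exact h1
    have hb2 := abs_le_of_sq_le_sq' (by simpa using hb1 : b ^ 2 ≤ 1 ^ 2) zero_le_one
    refine ⟨(Real.arccos b, (Real.arcosh a : ℝ)), isSpheroidalCoord_prolate.2
      ⟨Real.arccos_nonneg _, Real.arccos_le_pi _, Real.arcosh a, Real.arcosh_nonneg ha1, rfl,
        ?_, ?_⟩⟩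
    · rw [Real.cos_arccos hb2.1 hb2.2, Real.cosh_arcosh ha1]
      exact hab
    · have h1 : 0 ≤ Real.sinh (Real.arcosh a) := Real.sinh_nonneg_iff.2 (Real.arcosh_nonneg ha1)
      have h2 : Real.sinh (Real.arcosh a) ^ 2 = a ^ 2 - 1 := by
        rw [Real.sinh_sq, Real.cosh_arcosh ha1]
      have h3 : 0 ≤ Real.sin (Real.arccos b) := Real.sin_nonneg_of_nonneg_of_le_pi
        (Real.arccos_nonneg _) (Real.arccos_le_pi _)
      have h4 : Real.sin (Real.arccos b) ^ 2 = 1 - b ^ 2 := by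
        rw [Real.sin_sq, Real.cos_arccos hb2.1 hb2.2]
      refine (sq_eq_sq₀ hρ (by positivity)).1 ?_
      rw [mul_pow, mul_pow, h2, h4, mul_assoc, hpr]
      field_simp
  · set A := x₀ ^ 2 + ρ ^ 2 - c ^ 2 with hA
    set D := Real.sqrt (A ^ 2 + 4 * c ^ 2 * x₀ ^ 2) with hD
    have hD2 : D ^ 2 = A ^ 2 + 4 * c ^ 2 * x₀ ^ 2 := Real.sq_sqrt (by positivity)
    have hDA : |A| ≤ D := Real.abs_le_sqrt (by nlinarith [sq_nonneg (c * x₀)])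
    rw [abs_le] at hDA
    obtain ⟨a, ha⟩ : ∃ a, a = Real.sqrt ((A + D) / 2) / c := ⟨_, rfl⟩
    have ha0 : 0 ≤ a := by
      rw [ha]
      positivity
    have ha2 : c ^ 2 * a ^ 2 = (A + D) / 2 := by
      rw [ha, div_pow, Real.sq_sqrt (by linarith)]
      field_simp
    obtain ⟨b, hb2, hab⟩ : ∃ b, c ^ 2 * b ^ 2 = (D - A) / 2 ∧ x₀ = c * b * a := by
      have h1 : (c * (Real.sqrt ((D - A) / 2) / c) * a) ^ 2 = x₀ ^ 2 := by
        have : c ^ 2 * (c * (Real.sqrt ((D - A) / 2) / c) * a) ^ 2 = c ^ 2 * x₀ ^ 2 := by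
          rw [mul_div_cancel₀ _ hc.ne', mul_pow, Real.sq_sqrt (by linarith)]
          linear_combination (D - A) / 2 * ha2 + hD2 / 4
        exact mul_left_cancel₀ (by positivity) this
      have h2 : c ^ 2 * (Real.sqrt ((D - A) / 2) / c) ^ 2 = (D - A) / 2 := by
        rw [div_pow, Real.sq_sqrt (by linarith)]
        field_simp
      rcases sq_eq_sq_iff_eq_or_eq_neg.1 h1 with h | h
      · exact ⟨_, h2, h.symm⟩
      · refine ⟨-(Real.sqrt ((D - A) / 2) / c), by rw [neg_sq]; exact h2, ?_⟩
        linarith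
    have hpr : c ^ 2 * (1 - b ^ 2) * (1 + a ^ 2) = ρ ^ 2 := by
      have : x₀ ^ 2 = c ^ 2 * b ^ 2 * a ^ 2 := by
        rw [hab]
        ring
      linarith
    have hb1 : b ^ 2 ≤ 1 := by
      by_contra! h
      have : 0 < c ^ 2 * (b ^ 2 - 1) * (1 + a ^ 2) :=
        mul_pos (mul_pos (by positivity) (by linarith)) (by positivity)
      nlinarith [sq_nonneg ρ]
    have hb3 := abs_le_of_sq_le_sq' (by simpa using hb1 : b ^ 2 ≤ 1 ^ 2) zero_le_one
    refine ⟨(Real.arccos b, (Real.arsinh a : ℂ) - (Real.pi / 2 : ℝ) * Complex.I),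
      (isSpheroidalCoord_oblate hc).2
      ⟨Real.arccos_nonneg _, Real.arccos_le_pi _, Real.arsinh a, Real.arsinh_nonneg_iff.2 ha0, rfl,
        ?_, ?_⟩⟩
    · rw [Real.cos_arccos hb3.1 hb3.2, Real.sinh_arsinh]
      exact hab
    · have h1 : 0 ≤ Real.cosh (Real.arsinh a) := (Real.cosh_pos _).le
      have h2 : Real.cosh (Real.arsinh a) ^ 2 = 1 + a ^ 2 := by
        rw [Real.cosh_sq, Real.sinh_arsinh]
        ring
      have h3 : 0 ≤ Real.sin (Real.arccos b) := Real.sin_nonneg_of_nonneg_of_le_pi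
        (Real.arccos_nonneg _) (Real.arccos_le_pi _)
      have h4 : Real.sin (Real.arccos b) ^ 2 = 1 - b ^ 2 := by
        rw [Real.sin_sq, Real.cos_arccos hb3.1 hb3.2]
      refine (sq_eq_sq₀ hρ (by positivity)).1 ?_
      rw [mul_pow, mul_pow, h2, h4]
      exact hpr.symm

theorem legendrePoly_comp_neg (n m : ℕ) :
    (Polynomial.derivative^[m] (legendrePoly n)).comp (-Polynomial.X) =
      (-1) ^ (n + m) * Polynomial.derivative^[m] (legendrePoly n) := by
  have key : ∀ (p : Polynomial ℂ) (j : ℕ), (Polynomial.derivative^[j] p).comp (-Polynomial.X) =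
      (-1) ^ j * Polynomial.derivative^[j] (p.comp (-Polynomial.X)) := by
    intro p j
    induction j with
    | zero => simp
    | succ j ih =>
      have h := congrArg Polynomial.derivative ih
      rw [Polynomial.derivative_comp, show ((-1 : Polynomial ℂ) ^ j) = Polynomial.C ((-1) ^ j) by
        simp, Polynomial.derivative_C_mul] at h
      simp only [Function.iterate_succ_apply', pow_succ]
      simp only [Polynomial.derivative_X, map_pow, map_neg,
        map_one] at h
      linear_combination -h
  have h1 : legendrePoly n = Polynomial.derivative^[n]
      (Polynomial.C (1 / (2 ^ n * (n.factorial : ℂ))) * (Polynomial.X ^ 2 - 1) ^ n) := by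
    rw [Polynomial.iterate_derivative_C_mul]
    rfl
  rw [h1, ← Function.iterate_add_apply, key, add_comm m n]
  congr 3
  simp

theorem spheroidalProduct_flip (μ : ℂ) (n m : ℕ) (u : ℝ) (v : ℂ) (hv : Complex.cosh v = 0) :
    spheroidalProduct μ n m (Real.pi - u) v = spheroidalProduct μ n m u v := by
  have h : ∀ z : ℂ, (Polynomial.derivative^[m] (legendrePoly n)).eval (-z) =
      (-1) ^ (n + m) * (Polynomial.derivative^[m] (legendrePoly n)).eval z := by
    intro z
    have := congrArg (Polynomial.eval z) (legendrePoly_comp_neg n m)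
    simpa [Polynomial.eval_comp] using this
  have h0 := h 0
  unfold spheroidalProduct assocLegendreCosh assocLegendreCut
  rw [hv, Real.cos_pi_sub, Complex.ofReal_neg, h, neg_sq]
  rcases neg_one_pow_eq_or ℂ (n + m) with e | e
  · rw [e, one_mul]
  · rw [e] at h0
    have : (Polynomial.derivative^[m] (legendrePoly n)).eval 0 = 0 := by
      rw [neg_zero] at h0
      linear_combination h0 / 2
    rw [this]
    simp

theorem meridionalU_eq {μ : ℂ} (hμ : μ ∈ spheroidalParams) (h0 : μ ≠ 0) (n m : ℕ)
    {x₀ ρ u : ℝ} {v : ℂ} (h : IsSpheroidalCoord μ x₀ ρ u v) :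
    meridionalU μ n m x₀ ρ = spheroidalProduct μ n m u v := by
  have hex : ∃ p : ℝ × ℂ, IsSpheroidalCoord μ x₀ ρ p.1 p.2 := ⟨(u, v), h⟩
  rw [meridionalU, if_neg h0, dif_pos hex]
  have h' := hex.choose_spec
  set u' := hex.choose.1
  set v' := hex.choose.2
  clear_value u' v'
  have hsc : ∀ y : ℝ, Real.sin y ^ 2 = 1 - Real.cos y ^ 2 := Real.sin_sq
  rcases hμ with ⟨t, ht0, -, rfl⟩ | ⟨c, hc, rfl⟩
  · have ht : 0 < t := lt_of_le_of_ne ht0 fun h => h0 (by simp [← h])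
    obtain ⟨hu0, hu1, w, hw, rfl, hx, hr⟩ := isSpheroidalCoord_prolate.1 h
    obtain ⟨hu0', hu1', w', hw', rfl, hx', hr'⟩ := isSpheroidalCoord_prolate.1 h'
    have e1 : Real.cos u * Real.cosh w = Real.cos u' * Real.cosh w' :=
      mul_left_cancel₀ ht.ne' (by linarith)
    have e2 : Real.sin u * Real.sinh w = Real.sin u' * Real.sinh w' :=
      mul_left_cancel₀ ht.ne' (by linarith)
    have e3 : (1 - Real.cos u ^ 2) * (Real.cosh w ^ 2 - 1) =
        (1 - Real.cos u' ^ 2) * (Real.cosh w' ^ 2 - 1) := by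
      rw [← hsc, ← hsc, ← Real.sinh_sq, ← Real.sinh_sq, ← mul_pow, ← mul_pow, e2]
    have e4 := congrArg (· ^ 2) e1
    simp only [mul_pow] at e4
    have b1 := Real.cos_sq_le_one u
    have b2 := Real.cos_sq_le_one u'
    have a1 := Real.one_le_cosh w
    have a2 := Real.one_le_cosh w'
    have ea : Real.cosh w ^ 2 = Real.cosh w' ^ 2 := by
      have : (Real.cosh w ^ 2 - Real.cosh w' ^ 2) * (Real.cosh w ^ 2 - Real.cos u' ^ 2) = 0 := by
        linear_combination (Real.cosh w ^ 2 - 1) * e4 + Real.cosh w ^ 2 * e3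
      rcases mul_eq_zero.1 this with h | h
      · linarith
      · nlinarith
    have ew : Real.cosh w = Real.cosh w' := (sq_eq_sq₀ (by linarith) (by linarith)).1 ea
    have eb : Real.cos u = Real.cos u' := by
      rw [ew] at e1
      exact mul_right_cancel₀ (Real.cosh_pos w').ne' e1
    have hww : w = w' := Real.cosh_injOn hw hw' ew
    rw [Real.injOn_cos ⟨hu0, hu1⟩ ⟨hu0', hu1'⟩ eb, hww]
  · obtain ⟨hu0, hu1, w, hw, rfl, hx, hr⟩ := (isSpheroidalCoord_oblate hc).1 h
    obtain ⟨hu0', hu1', w', hw', rfl, hx', hr'⟩ := (isSpheroidalCoord_oblate hc).1 h'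
    have e1 : Real.cos u * Real.sinh w = Real.cos u' * Real.sinh w' :=
      mul_left_cancel₀ hc.ne' (by linarith)
    have e2 : Real.sin u * Real.cosh w = Real.sin u' * Real.cosh w' :=
      mul_left_cancel₀ hc.ne' (by linarith)
    have e3 : (1 - Real.cos u ^ 2) * (Real.sinh w ^ 2 + 1) =
        (1 - Real.cos u' ^ 2) * (Real.sinh w' ^ 2 + 1) := by
      rw [← hsc, ← hsc, ← Real.cosh_sq, ← Real.cosh_sq, ← mul_pow, ← mul_pow, e2]
    have e4 := congrArg (· ^ 2) e1
    simp only [mul_pow] at e4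
    have a1 := Real.sinh_nonneg_iff.2 hw
    have a2 := Real.sinh_nonneg_iff.2 hw'
    have ea : Real.sinh w ^ 2 = Real.sinh w' ^ 2 := by
      have : (Real.sinh w ^ 2 - Real.sinh w' ^ 2) * (Real.sinh w ^ 2 + Real.cos u' ^ 2) = 0 := by
        linear_combination (Real.sinh w ^ 2 + 1) * e4 + Real.sinh w ^ 2 * e3
      rcases mul_eq_zero.1 this with h | h
      · linarith
      · nlinarith [sq_nonneg (Real.sinh w), sq_nonneg (Real.cos u'), sq_nonneg (Real.sinh w'),
          sq_nonneg (Real.cos u)]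
    have ew : Real.sinh w = Real.sinh w' := (sq_eq_sq₀ a1 a2).1 ea
    have hww : w = w' := Real.sinh_injective ew
    subst hww
    by_cases hs : Real.sinh w = 0
    · have hcosh : Complex.cosh ((w : ℂ) - (Real.pi / 2 : ℝ) * Complex.I) = 0 := by
        rw [cosh_oblate, hs]
        simp
      have eb : Real.cos u ^ 2 = Real.cos u' ^ 2 := by
        rw [hs] at e3
        linarith
      rcases sq_eq_sq_iff_eq_or_eq_neg.1 eb with eb | eb
      · rw [Real.injOn_cos ⟨hu0, hu1⟩ ⟨hu0', hu1'⟩ eb]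
      · have : u = Real.pi - u' := Real.injOn_cos ⟨hu0, hu1⟩
          ⟨by linarith, by linarith⟩ (by rw [Real.cos_pi_sub, eb])
        rw [this, spheroidalProduct_flip _ _ _ _ _ hcosh]
    · rw [Real.injOn_cos ⟨hu0, hu1⟩ ⟨hu0', hu1'⟩ (mul_right_cancel₀ hs e1)]

open Polynomial

/-! Everything is read off the axis. With w = ρ², the function ρ^m h(x₀, w) Φ_m(φ) satisfies
Laplace's equation when h_xx + 4 w h_ww + 4 (m+1) h_w = 0, and a polynomial f in x₀ has an explicit
polynomial solution with axis values f / m!, namely `axialExtension m f`. Up to a constant and the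
factor (-ρ)^m, U_{n,m}[μ] comes from the axis polynomial μ^{n-m} P_n^{(m)}(x₀/μ) if μ ≠ 0
(`meridionalU_eq_axialSlice`) and from x₀^{n-m} if μ = 0 (`meridionalU_zero_eq_axialSlice`).

The extension is linear and commutes with ∂/∂x₀, so V_{n-2k,m}[μ] comes from P_{n-2k+1}^{(m+1)}. For
μ ≠ 0 the proposition thus reduces to an identity in one variable: the expansion of x^{n+1}/(n+1)!
in Legendre polynomials of degrees n+1-2k, differentiated m+1 times
(`sum_legendreExpansionCoeff_mul_iterate_derivative`). Homogeneity of the extended monomial accounts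
for the powers of μ. For μ = 0 only the term k = 0 remains.

The link with spheroidal coordinates is a separation argument. Substituting x = b a, w = (b² - 1)(1
- a²) into the extension of P_n^{(m)} gives a polynomial in a that solves the ultraspherical
equation of P_n^{(m)} (`ultrasphericalEq_spheroidalSubst`). Polynomial solutions are fixed by their
value at a = 1, which lies on the axis, so the result is a constant multiple of P_n^{(m)}(a)
P_n^{(m)}(b). -/

theorem Polynomial.eq_of_derivative_eq_of_eval_eq {F G : ℂ[X]} {a : ℂ}
    (h : derivative F = derivative G) (ha : F.eval a = G.eval a) : F = G := by
  have h' : derivative (F - G) = 0 := by rw [derivative_sub, h, sub_self]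
  have ha' : (F - G).eval a = 0 := by rw [eval_sub, ha, sub_self]
  rw [eq_C_of_derivative_eq_zero h', eval_C] at ha'
  rw [← sub_eq_zero, eq_C_of_derivative_eq_zero h', ha', C_0]

/-! ### Polynomial solutions of the ultraspherical equation -/

/-- The ultraspherical differential equation `(1 - X²) F'' - 2 a X F' + l F = 0`. -/
def UltrasphericalEq (a l : ℂ) (F : ℂ[X]) : Prop :=
  (1 - X ^ 2) * derivative (derivative F) - C (2 * a) * X * derivative F + C l * F = 0

namespace UltrasphericalEq

/-- Differentiation stays within the family and raises a by one, so Legendre derivatives of every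
order can be reached from (X² - 1)^n. -/
theorem derivative {a l : ℂ} {F : ℂ[X]} (h : UltrasphericalEq a l F) :
    UltrasphericalEq (a + 1) (l - 2 * a) (derivative F) := by
  have h' := congrArg Polynomial.derivative h
  unfold UltrasphericalEq at h ⊢
  simp only [derivative_add, derivative_sub, derivative_mul, derivative_C, derivative_X,
    derivative_X_pow, derivative_one, derivative_zero] at h'
  simp only [mul_add, map_add, map_sub, map_mul, mul_one, map_ofNat] at h' ⊢
  simp only [Nat.cast_ofNat, map_ofNat] at h'
  linear_combination h'

theorem iterate_derivative {a l : ℂ} {F : ℂ[X]} (h : UltrasphericalEq a l F) (k : ℕ) :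
    UltrasphericalEq (a + k) (l - 2 * k * a - k * (k - 1)) (Polynomial.derivative^[k] F) := by
  induction k with
  | zero => simpa using h
  | succ k ih =>
    rw [Function.iterate_succ_apply']
    convert ih.derivative using 1
    · push_cast; ring
    · push_cast; ring

/-- The point 1 is singular: the second-order term drops out there, and F(1) controls F'(1). -/
theorem eval_one {a l : ℂ} {F : ℂ[X]} (h : UltrasphericalEq a l F) :
    2 * a * (Polynomial.derivative F).eval 1 = l * F.eval 1 := by
  have h' := congrArg (Polynomial.eval 1) h
  simp at h'
  linear_combination -h'

theorem add {a l : ℂ} {F G : ℂ[X]} (hF : UltrasphericalEq a l F) (hG : UltrasphericalEq a l G) :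
    UltrasphericalEq a l (F + G) := by
  unfold UltrasphericalEq at *
  simp only [derivative_add]
  linear_combination hF + hG

theorem C_mul {a l : ℂ} {F : ℂ[X]} (c : ℂ) (hF : UltrasphericalEq a l F) :
    UltrasphericalEq a l (C c * F) := by
  unfold UltrasphericalEq at *
  simp only [derivative_C_mul]
  linear_combination C c * hF

/-- Since a = α + 1 ≠ 0, `eval_one` gives F'(1) = 0, and F' solves the equation with parameter a +
1. Induction on the degree yields F' = 0, so F is the constant F(1) = 0. -/
theorem eq_zero {F : ℂ[X]} (α : ℕ) {l : ℂ} (h : UltrasphericalEq (α + 1) l F)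
    (h1 : F.eval 1 = 0) : F = 0 := by
  obtain ⟨d, hd⟩ : ∃ d, F.natDegree ≤ d := ⟨_, le_rfl⟩
  induction d generalizing F α l with
  | zero =>
    exact eq_of_derivative_eq_of_eval_eq (a := 1)
      (by rw [derivative_of_natDegree_zero (by omega), derivative_zero]) (by simpa using h1)
  | succ d ih =>
    refine eq_of_derivative_eq_of_eval_eq (a := 1)
      ((ih (α + 1) (by simpa using h.derivative) ?_ ?_).trans derivative_zero.symm) (by simpa using h1)
    · have := h.eval_one
      rw [h1, mul_zero] at this
      exact (mul_eq_zero.1 this).resolve_left (mul_ne_zero two_ne_zero (Nat.cast_add_one_ne_zero α))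
    · have := natDegree_derivative_le F
      omega

/-- Polynomial solutions are determined by their value at `1`. -/
theorem eq_of_eval_one {F G : ℂ[X]} (α : ℕ) {l : ℂ} (hF : UltrasphericalEq (α + 1) l F)
    (hG : UltrasphericalEq (α + 1) l G) (h1 : F.eval 1 = G.eval 1) : F = G := by
  have := (hF.add (hG.C_mul (-1))).eq_zero α (by simp [h1])
  simpa [add_neg_eq_zero] using this

end UltrasphericalEq

/-! ### Legendre polynomials and their derivatives -/

theorem legendrePoly_eval_one (n : ℕ) : (legendrePoly n).eval 1 = 1 := by
  -- Write (X² - 1)^n = (X - 1)^n (X + 1)^n: at 1 only the term with all n derivatives on the first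
  -- factor survives, giving n! 2^n.
  have h := aeval_iterate_derivative_self (A := ℂ) (((X : ℂ[X]) ^ 2 - 1) ^ n) n 1
    (p' := (X + 1) ^ n) (by
      rw [Algebra.algebraMap_self, Polynomial.map_id, ← mul_pow]
      congr 1
      rw [C_1]; ring)
  rw [coe_aeval_eq_eval] at h
  rw [legendrePoly, eval_mul, eval_C, h]
  have : (n.factorial : ℂ) ≠ 0 := by exact_mod_cast n.factorial_ne_zero
  simp only [eval_pow, eval_add, eval_X, eval_one, nsmul_eq_mul]
  norm_num
  field_simp

/-- The starting point for Rodrigues' formula: m + n differentiations turn the parameter 1 - n into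
m + 1. -/
theorem ultrasphericalEq_X_sq_sub_one_pow (n : ℕ) :
    UltrasphericalEq (1 - n) (2 * n) ((X ^ 2 - 1) ^ n) := by
  unfold UltrasphericalEq
  rcases n with _ | _ | n
  · simp
  · simp [derivative_pow]
    ring
  · simp [derivative_pow]
    ring

theorem ultrasphericalEq_legendrePoly (n m : ℕ) :
    UltrasphericalEq (m + 1) ((n - m) * (n + m + 1)) (derivative^[m] (legendrePoly n)) := by
  have h := ((ultrasphericalEq_X_sq_sub_one_pow n).iterate_derivative (m + n)).C_mul
    (1 / (2 ^ n * (n.factorial : ℂ)))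
  rw [legendrePoly, iterate_derivative_C_mul, ← Function.iterate_add_apply]
  convert h using 1
  · push_cast; ring
  · push_cast; ring

/-- By `eval_one`, the values satisfy 2 (m+1) P_n^{(m+1)}(1) = (n-m)(n+m+1) P_n^{(m)}(1). -/
theorem iterate_derivative_legendrePoly_eval_one {n m : ℕ} (h : m ≤ n) :
    (derivative^[m] (legendrePoly n)).eval 1 =
      (n + m).factorial / (2 ^ m * m.factorial * (n - m).factorial) := by
  induction m with
  | zero =>
    have : (n.factorial : ℂ) ≠ 0 := by exact_mod_cast n.factorial_ne_zero
    simp [legendrePoly_eval_one, this]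
  | succ m ih =>
    have e := (ultrasphericalEq_legendrePoly n m).eval_one
    rw [ih (by omega), ← Function.iterate_succ_apply' (f := derivative)] at e
    obtain ⟨r, rfl⟩ := Nat.exists_eq_add_of_le h
    rw [show m + 1 + r - m = r + 1 by omega] at e
    rw [show m + 1 + r - (m + 1) = r by omega, show m + 1 + r + (m + 1) = (m + 1 + r + m) + 1 by ring]
    have h1 : (m : ℂ) + 1 ≠ 0 := Nat.cast_add_one_ne_zero m
    have h2 : (r : ℂ) + 1 ≠ 0 := Nat.cast_add_one_ne_zero r
    have f1 : (m.factorial : ℂ) ≠ 0 := by exact_mod_cast m.factorial_ne_zero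
    have f2 : (r.factorial : ℂ) ≠ 0 := by exact_mod_cast r.factorial_ne_zero
    have h3 : 2 * ((m : ℂ) + 1) ≠ 0 := mul_ne_zero two_ne_zero h1
    refine mul_left_cancel₀ h3 (e.trans ?_)
    rw [Nat.factorial_succ (m + 1 + r + m), Nat.factorial_succ r, Nat.factorial_succ m]
    push_cast
    field_simp
    ring

/-- Rodrigues' formula reduces this to the second derivative of (X² - 1)^{n+1}. The truncated index
n - 1 at n = 0 is harmless, because P_0 is constant. -/
theorem derivative_legendrePoly_succ (n : ℕ) :
    derivative (legendrePoly (n + 1)) =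
      C (2 * (n : ℂ) + 1) * legendrePoly n + derivative (legendrePoly (n - 1)) := by
  rcases n with _ | n
  · simp [legendrePoly, derivative_pow]
    simp [← C_mul]
  -- The factor X² produced by two differentiations is split as (X² - 1) + 1.
  · have key : derivative^[2] ((X ^ 2 - 1 : ℂ[X]) ^ (n + 2)) =
        C (2 * ((n : ℂ) + 2)) * (C (2 * (n : ℂ) + 3) * (X ^ 2 - 1) ^ (n + 1) +
          C (2 * ((n : ℂ) + 1)) * (X ^ 2 - 1) ^ n) := by
      simp [derivative_pow]
      simp only [map_ofNat]
      ring
    have h := congrArg (derivative^[n + 1]) key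
    rw [iterate_derivative_C_mul, iterate_map_add derivative, iterate_derivative_C_mul,
      iterate_derivative_C_mul, ← Function.iterate_add_apply] at h
    have f0 : (n.factorial : ℂ) ≠ 0 := by exact_mod_cast n.factorial_ne_zero
    have f1 : (n : ℂ) + 1 ≠ 0 := Nat.cast_add_one_ne_zero n
    have f2 : (n : ℂ) + 1 + 1 ≠ 0 := by exact_mod_cast (Nat.succ_ne_zero (n + 1))
    simp only [legendrePoly, Nat.add_sub_cancel, derivative_C_mul]
    rw [← Function.iterate_succ_apply' (f := derivative),
      ← Function.iterate_succ_apply' (f := derivative),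
      show (n + 1 + 1).succ = n + 1 + 2 from rfl, show n + 1 + 1 = n + 2 by ring, h]
    simp only [mul_add, ← mul_assoc, ← C_mul]
    congr 3
    · rw [Nat.factorial_succ, Nat.factorial_succ]
      push_cast
      field_simp
      ring
    · rw [Nat.factorial_succ, Nat.factorial_succ]
      push_cast
      field_simp
      ring

/-! ### Harmonic extension from the axis -/

/-- The coefficients `(-1/4)^i / (i! (i+m)!)` of the axial expansion. -/
noncomputable def axialCoeff (m i : ℕ) : ℂ :=
  (-1 / 4) ^ i / (i.factorial * (i + m).factorial)

/-- This recurrence is Laplace's equation read at w^i: there 4 w ∂_w² + 4 (m+1) ∂_w contributes the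
factor 4 (i+1)(i+1+m). -/
theorem axialCoeff_succ (m i : ℕ) :
    4 * ((i : ℂ) + 1) * (i + 1 + m) * axialCoeff m (i + 1) = -axialCoeff m i := by
  have f0 : (i.factorial : ℂ) ≠ 0 := by exact_mod_cast i.factorial_ne_zero
  have f1 : ((i + m).factorial : ℂ) ≠ 0 := by exact_mod_cast (i + m).factorial_ne_zero
  have f2 : (i : ℂ) + 1 ≠ 0 := Nat.cast_add_one_ne_zero i
  have f3 : (i : ℂ) + 1 + m ≠ 0 := by
    have := Nat.cast_add_one_ne_zero (R := ℂ) (i + m)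
    push_cast at this
    convert this using 1
    ring
  unfold axialCoeff
  rw [show i + 1 + m = i + m + 1 by ring, Nat.factorial_succ, Nat.factorial_succ]
  have f4 : ((i + m : ℕ) : ℂ) + 1 = i + 1 + m := by push_cast; ring
  push_cast at f4 ⊢
  rw [f4, pow_succ]
  field_simp

/-- The polynomial `∑ᵢ (-w/4)^i / (i! (i+m)!) f^{(2i)}(x)` in `x` (inner variable) and `w` (outer
variable): the axially expanded harmonic function with values `f / m!` on the axis,
in terms of `w = ρ²`. -/
noncomputable def axialExtension (m : ℕ) (f : ℂ[X]) : ℂ[X][X] :=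
  ∑ i ∈ Finset.range (f.natDegree + 1), monomial i (C (axialCoeff m i) * derivative^[2 * i] f)

/-- The cut-off at `natDegree` loses nothing, since the later derivatives vanish. Identities for the
extension can therefore be checked coefficientwise without tracking degrees. -/
theorem coeff_axialExtension (m : ℕ) (f : ℂ[X]) (i : ℕ) :
    (axialExtension m f).coeff i = C (axialCoeff m i) * derivative^[2 * i] f := by
  simp only [axialExtension, finsetSum_coeff, coeff_monomial, Finset.sum_ite_eq', Finset.mem_range]
  split_ifs with h
  · rfl
  · rw [iterate_derivative_eq_zero (by omega), mul_zero]

theorem axialExtension_add (m : ℕ) (f g : ℂ[X]) :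
    axialExtension m (f + g) = axialExtension m f + axialExtension m g := by
  ext1 i
  simp only [coeff_axialExtension, coeff_add, iterate_map_add derivative, mul_add]

theorem axialExtension_C_mul (m : ℕ) (c : ℂ) (f : ℂ[X]) :
    axialExtension m (C c * f) = C (C c) * axialExtension m f := by
  ext1 i
  simp only [coeff_axialExtension, coeff_C_mul, iterate_derivative_C_mul]
  ring

theorem axialExtension_sum (m : ℕ) {ι : Type*} (s : Finset ι) (c : ι → ℂ) (f : ι → ℂ[X]) :
    axialExtension m (∑ k ∈ s, C (c k) * f k) = ∑ k ∈ s, C (C (c k)) * axialExtension m (f k) := by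
  classical
  induction s using Finset.induction_on with
  | empty => simpa using axialExtension_C_mul m 0 0
  | insert a s ha ih =>
    rw [Finset.sum_insert ha, Finset.sum_insert ha, axialExtension_add, ih, axialExtension_C_mul]

/-- The derivative with respect to the inner variable of a polynomial in two variables. -/
noncomputable def innerDerivative (h : ℂ[X][X]) : ℂ[X][X] :=
  ∑ i ∈ Finset.range (h.natDegree + 1), monomial i (derivative (h.coeff i))

theorem coeff_innerDerivative (h : ℂ[X][X]) (i : ℕ) :
    (innerDerivative h).coeff i = derivative (h.coeff i) := by
  simp only [innerDerivative, finsetSum_coeff, coeff_monomial, Finset.sum_ite_eq', Finset.mem_range]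
  split_ifs with hi
  · rfl
  · rw [coeff_eq_zero_of_natDegree_lt (by omega), derivative_zero]

theorem innerDerivative_add (g h : ℂ[X][X]) :
    innerDerivative (g + h) = innerDerivative g + innerDerivative h := by
  ext1 i
  simp only [coeff_innerDerivative, coeff_add, derivative_add]

theorem innerDerivative_monomial (i : ℕ) (f : ℂ[X]) :
    innerDerivative (monomial i f) = monomial i (derivative f) := by
  ext1 j
  simp only [coeff_innerDerivative, coeff_monomial]
  split_ifs <;> simp

theorem innerDerivative_C_X_mul (h : ℂ[X][X]) :
    innerDerivative (C X * h) = h + C X * innerDerivative h := by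
  ext1 i
  simp [coeff_innerDerivative]

theorem innerDerivative_X_mul (h : ℂ[X][X]) :
    innerDerivative (X * h) = X * innerDerivative h := by
  ext1 i
  rcases i with _ | i <;> simp [coeff_innerDerivative]

theorem innerDerivative_C_C_mul (c : ℂ) (h : ℂ[X][X]) :
    innerDerivative (C (C c) * h) = C (C c) * innerDerivative h := by
  ext1 i
  simp [coeff_innerDerivative]

theorem innerDerivative_derivative (h : ℂ[X][X]) :
    innerDerivative (derivative h) = derivative (innerDerivative h) := by
  ext1 i
  simp [coeff_innerDerivative, coeff_derivative]

theorem axialExtension_derivative (m : ℕ) (f : ℂ[X]) :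
    axialExtension m (derivative f) = innerDerivative (axialExtension m f) := by
  ext1 i
  rw [coeff_axialExtension, coeff_innerDerivative, coeff_axialExtension, derivative_C_mul,
    ← Function.iterate_succ_apply, ← Function.iterate_succ_apply' (f := derivative)]

/-- Laplace's equation for the axial extension. -/
theorem axialExtension_harmonic (m : ℕ) (f : ℂ[X]) :
    innerDerivative (innerDerivative (axialExtension m f)) +
      C (C 4) * (X * derivative (derivative (axialExtension m f))) +
      C (C (4 * ((m : ℂ) + 1))) * derivative (axialExtension m f) = 0 := by
  ext1 i
  simp only [coeff_add, coeff_C_mul, coeff_innerDerivative, coeff_axialExtension, derivative_C_mul]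
  have e2 : derivative (derivative (derivative^[2 * i] f)) = derivative^[2 * (i + 1)] f := by
    rw [← Function.iterate_succ_apply' (f := derivative),
      ← Function.iterate_succ_apply' (f := derivative)]
    rfl
  have e1 := congrArg C (axialCoeff_succ m i)
  rcases i with _ | i
  · simp only [mul_coeff_zero, coeff_X_zero, coeff_derivative, coeff_axialExtension, e2]
    simp at e1 ⊢
    linear_combination (derivative (derivative f)) * e1
  · simp only [coeff_X_mul, coeff_derivative, coeff_axialExtension, e2]
    simp at e1 ⊢
    linear_combination (derivative^[2 * (i + 1 + 1)] f) * e1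

theorem iterate_derivative_X_mul (k : ℕ) (f : ℂ[X]) :
    derivative^[k] (X * f) = X * derivative^[k] f + C (k : ℂ) * derivative^[k - 1] f := by
  induction k with
  | zero => simp
  | succ k ih =>
    rw [Function.iterate_succ_apply', ih, derivative_add, derivative_mul, derivative_C_mul,
      Function.iterate_succ_apply']
    rcases k with _ | k
    · simp
      ring
    · simp only [Nat.add_sub_cancel, Function.iterate_succ_apply', derivative_X, Nat.cast_succ,
        C_add, C_1]
      ring

/-- The Euler operator x ∂_x extends to x ∂_x + 2 w ∂_w, since w = ρ² has weight two: the
coefficient of w^i carries 2i derivatives, and moving x past them produces the extra 2i. -/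
theorem axialExtension_euler (m : ℕ) (f : ℂ[X]) :
    axialExtension m (X * derivative f) =
      C X * innerDerivative (axialExtension m f) +
        C (C 2) * (X * derivative (axialExtension m f)) := by
  ext1 i
  simp only [coeff_add, coeff_C_mul, coeff_innerDerivative, coeff_axialExtension, derivative_C_mul]
  rw [iterate_derivative_X_mul, ← Function.iterate_succ_apply (f := derivative),
    ← Function.iterate_succ_apply (f := derivative),
    ← Function.iterate_succ_apply' (f := derivative)]
  rcases i with _ | i
  · simp
    ring
  · simp only [coeff_X_mul, coeff_derivative, coeff_axialExtension]
    rw [show (2 * (i + 1) - 1).succ = 2 * (i + 1) by omega]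
    simp
    ring

theorem eval_zero_axialExtension (m : ℕ) (f : ℂ[X]) :
    (axialExtension m f).eval 0 = C (1 / (m.factorial : ℂ)) * f := by
  rw [← coeff_zero_eq_eval_zero, coeff_axialExtension]
  simp [axialCoeff]

/-! ### Separation of variables in spheroidal coordinates -/

/-- Substitution of `x = b a` and `w = q (1 - a²)`, as a polynomial in `a`. -/
noncomputable def spheroidalSubst (b q : ℂ) : ℂ[X][X] →+* ℂ[X] :=
  eval₂RingHom (compRingHom (C b * X)) (C q * (1 - X ^ 2))

theorem spheroidalSubst_C (b q : ℂ) (f : ℂ[X]) : spheroidalSubst b q (C f) = f.comp (C b * X) := by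
  simp [spheroidalSubst]

theorem spheroidalSubst_X (b q : ℂ) : spheroidalSubst b q X = C q * (1 - X ^ 2) := by
  simp [spheroidalSubst]

theorem eval_spheroidalSubst (b q a : ℂ) (h : ℂ[X][X]) :
    (spheroidalSubst b q h).eval a = (h.eval (C (q * (1 - a ^ 2)))).eval (b * a) := by
  induction h using Polynomial.induction_on' with
  | add g h hg hh => simp [hg, hh]
  | monomial i f =>
    simp [← C_mul_X_pow_eq_monomial, spheroidalSubst_C, spheroidalSubst_X, eval_comp]

theorem eval_one_spheroidalSubst (b q : ℂ) (m : ℕ) (f : ℂ[X]) :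
    (spheroidalSubst b q (axialExtension m f)).eval 1 = f.eval b / m.factorial := by
  rw [eval_spheroidalSubst]
  simp [eval_zero_axialExtension]
  ring

theorem derivative_spheroidalSubst (b q : ℂ) (h : ℂ[X][X]) :
    derivative (spheroidalSubst b q h) =
      C b * spheroidalSubst b q (innerDerivative h) -
        C (2 * q) * X * spheroidalSubst b q (derivative h) := by
  induction h using Polynomial.induction_on' with
  | add g h hg hh =>
    rw [map_add, derivative_add, hg, hh, innerDerivative_add, derivative_add, map_add, map_add]
    ring
  | monomial i f =>
    rw [innerDerivative_monomial, derivative_monomial]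
    simp only [← C_mul_X_pow_eq_monomial, map_mul, map_pow, spheroidalSubst_C, spheroidalSubst_X]
    rw [derivative_mul, derivative_comp, derivative_pow]
    simp
    simp only [map_ofNat]
    ring

/-- The equation for f carries over to the extension, and Laplace's equation removes what is not a
derivative along the curve a ↦ (b a, q (1 - a²)). The parameter c treats together the spheroidal
case c = 1 and the spherical case c = 0. -/
theorem ultrasphericalEq_spheroidalSubst {m : ℕ} {b q c l : ℂ} (hq : q = b ^ 2 - c) {f : ℂ[X]}
    (hf : (C c - X ^ 2) * derivative (derivative f) - C (2 * ((m : ℂ) + 1)) * X * derivative f +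
      C l * f = 0) :
    UltrasphericalEq (m + 1) l (spheroidalSubst b q (axialExtension m f)) := by
  -- In terms of d/dx and x d/dx alone, each term has a known extension.
  have hf' : C l * f = C (-c) * derivative (derivative f) + X * derivative (X * derivative f) +
      C (2 * (m : ℂ) + 1) * (X * derivative f) := by
    simp at hf ⊢
    simp only [map_ofNat] at hf ⊢
    linear_combination hf
  have h1 := congrArg (axialExtension m) hf'
  simp only [axialExtension_add, axialExtension_C_mul, axialExtension_euler,
    axialExtension_derivative] at h1
  have h0 := axialExtension_harmonic m f
  generalize axialExtension m f = h at *
  simp only [innerDerivative_add, innerDerivative_C_X_mul, innerDerivative_C_C_mul,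
    innerDerivative_X_mul, innerDerivative_derivative, derivative_add, derivative_mul,
    derivative_C, derivative_X] at h1
  replace h0 := congrArg (spheroidalSubst b q) h0
  replace h1 := congrArg (spheroidalSubst b q) h1
  rw [UltrasphericalEq]
  simp only [derivative_spheroidalSubst, derivative_sub, derivative_mul,
    innerDerivative_derivative, derivative_C, derivative_X]
  simp only [map_add, map_mul, map_zero, map_one, spheroidalSubst_C, spheroidalSubst_X, C_comp,
    X_comp] at h0 h1
  subst hq
  simp only [C_add, C_sub, C_mul, C_pow, C_neg, map_ofNat, C_1] at h0 h1 ⊢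
  linear_combination h1 + (C b ^ 2 - C c) * h0

/-- The harmonic function extending a Legendre derivative from the axis separates in spheroidal
coordinates. -/
theorem legendrePoly_mul_legendrePoly {n m : ℕ} (h : m ≤ n) (a b : ℂ) :
    (derivative^[m] (legendrePoly n)).eval a * (derivative^[m] (legendrePoly n)).eval b =
      (n + m).factorial / (2 ^ m * (n - m).factorial) *
        (spheroidalSubst b (b ^ 2 - 1)
          (axialExtension m (derivative^[m] (legendrePoly n)))).eval a := by
  have hp := ultrasphericalEq_legendrePoly n m
  have h1 := iterate_derivative_legendrePoly_eval_one h
  set p := derivative^[m] (legendrePoly n)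
  have f1 : (m.factorial : ℂ) ≠ 0 := by exact_mod_cast m.factorial_ne_zero
  have f2 : ((n - m).factorial : ℂ) ≠ 0 := by exact_mod_cast (n - m).factorial_ne_zero
  have key : C (p.eval b) * p = C ((n + m).factorial / (2 ^ m * (n - m).factorial) : ℂ) *
      spheroidalSubst b (b ^ 2 - 1) (axialExtension m p) := by
    refine (hp.C_mul _).eq_of_eval_one m
      ((ultrasphericalEq_spheroidalSubst (c := 1) rfl hp).C_mul _) ?_
    rw [eval_mul, eval_mul, eval_C, eval_C, h1, eval_one_spheroidalSubst]
    field_simp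
  have := congrArg (Polynomial.eval a) key
  rw [eval_mul, eval_mul, eval_C, eval_C] at this
  rw [mul_comm, this]

/-- The classical solid harmonics: `P_n^{(m)}` on the unit sphere in terms of the axis values. -/
theorem eval_iterate_derivative_legendrePoly {n m : ℕ} (h : m ≤ n) (t : ℂ) :
    (derivative^[m] (legendrePoly n)).eval t =
      (n + m).factorial / 2 ^ m *
        (spheroidalSubst 1 1
          (axialExtension m (C (1 / ((n - m).factorial : ℂ)) * X ^ (n - m)))).eval t := by
  have hp := ultrasphericalEq_legendrePoly n m
  have h1 := iterate_derivative_legendrePoly_eval_one h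
  set p := derivative^[m] (legendrePoly n)
  have f1 : (m.factorial : ℂ) ≠ 0 := by exact_mod_cast m.factorial_ne_zero
  have f2 : ((n - m).factorial : ℂ) ≠ 0 := by exact_mod_cast (n - m).factorial_ne_zero
  -- For c = 0 the equation is Euler's, solved by a monomial with the same eigenvalue as P_n^{(m)}.
  -- Taking b = q = 1 then restricts the extension to the unit sphere x = a, w = 1 - a².
  have hX : (C (0 : ℂ) - X ^ 2) * derivative (derivative ((X : ℂ[X]) ^ (n - m))) -
      C (2 * ((m : ℂ) + 1)) * X * derivative (X ^ (n - m)) +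
        C (((n : ℂ) - m) * (n + m + 1)) * X ^ (n - m) = 0 := by
    obtain ⟨r, rfl⟩ := Nat.exists_eq_add_of_le h
    rw [Nat.add_sub_cancel_left]
    rcases r with _ | _ | r
    · simp
    · simp
      simp only [map_ofNat]
      ring
    · simp
      simp only [map_ofNat]
      ring
  have key : p = C ((n + m).factorial / 2 ^ m : ℂ) * spheroidalSubst 1 1
      (axialExtension m (C (1 / ((n - m).factorial : ℂ)) * X ^ (n - m))) := by
    rw [axialExtension_C_mul, map_mul, spheroidalSubst_C, C_comp]
    refine hp.eq_of_eval_one m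
      (((ultrasphericalEq_spheroidalSubst (c := 0) (by norm_num) hX).C_mul _).C_mul _) ?_
    rw [eval_mul, eval_mul, eval_C, eval_C, h1, eval_one_spheroidalSubst]
    simp
    field_simp
  conv_lhs => rw [key]
  rw [eval_mul, eval_C]

/-! ### Expansion of monomials in Legendre polynomials -/

/-- The coefficients `2^{n-2k} (n-k)! / (k! (2n-2k+1)!)`. -/
noncomputable def legendreExpansionCoeff (n k : ℕ) : ℂ :=
  2 ^ n / 4 ^ k * (n - k).factorial / (k.factorial * (2 * n - 2 * k + 1).factorial)

theorem legendreExpansionCoeff_zero (n : ℕ) :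
    legendreExpansionCoeff (n + 1) 0 * (2 * (n + 1 : ℕ) + 1) = legendreExpansionCoeff n 0 := by
  have f : ∀ k : ℕ, (k.factorial : ℂ) ≠ 0 := fun k => by exact_mod_cast k.factorial_ne_zero
  have g : ∀ k : ℕ, (k : ℂ) + 1 ≠ 0 := fun k => Nat.cast_add_one_ne_zero k
  have g1 := g (2 * n + 1 + 1)
  have g2 := g (2 * n + 1)
  have g3 := f (2 * n + 1)
  unfold legendreExpansionCoeff
  rw [show 2 * (n + 1) - 2 * 0 + 1 = 2 * n + 1 + 1 + 1 by omega,
    show 2 * n - 2 * 0 + 1 = 2 * n + 1 by omega, Nat.sub_zero, Nat.sub_zero,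
    Nat.factorial_succ (2 * n + 1 + 1), Nat.factorial_succ (2 * n + 1), Nat.factorial_succ n]
  push_cast at g1 g2 ⊢
  rw [div_mul_eq_mul_div, div_eq_div_iff (by simp [g1, g2, g3]) (by simp [g3])]
  ring

/-- Differentiating the expansion in degree n + 1 must return the one in degree n; this difference
relation is what that requires. It makes the sums below telescope. -/
theorem legendreExpansionCoeff_succ {n k : ℕ} (h : k + 1 ≤ n) :
    legendreExpansionCoeff (n + 1) (k + 1) * (2 * ((n : ℂ) + 1 - 2 * (k + 1)) + 1) =
      legendreExpansionCoeff n (k + 1) - legendreExpansionCoeff n k := by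
  obtain ⟨r, rfl⟩ := Nat.exists_eq_add_of_le h
  have f : ∀ k : ℕ, (k.factorial : ℂ) ≠ 0 := fun k => by exact_mod_cast k.factorial_ne_zero
  have g : ∀ k : ℕ, (k : ℂ) + 1 ≠ 0 := fun k => Nat.cast_add_one_ne_zero k
  have g1 := g (2 * r + 1 + 1)
  have g2 := g (2 * r + 1)
  have g3 := f (2 * r + 1)
  have g4 := g k
  have g5 := f r
  have g6 := f k
  have g7 := g r
  unfold legendreExpansionCoeff
  rw [show 2 * (k + 1 + r + 1) - 2 * (k + 1) + 1 = 2 * r + 1 + 1 + 1 by omega,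
    show 2 * (k + 1 + r) - 2 * (k + 1) + 1 = 2 * r + 1 by omega,
    show 2 * (k + 1 + r) - 2 * k + 1 = 2 * r + 1 + 1 + 1 by omega,
    show k + 1 + r + 1 - (k + 1) = r + 1 by omega, show k + 1 + r - (k + 1) = r by omega,
    show k + 1 + r - k = r + 1 by omega,
    Nat.factorial_succ (2 * r + 1 + 1), Nat.factorial_succ (2 * r + 1), Nat.factorial_succ r,
    Nat.factorial_succ k]
  push_cast at g1 g2 ⊢
  rw [pow_succ (4 : ℂ) k, pow_succ (2 : ℂ) (k + 1 + r)]
  field_simp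
  ring

/-- The index (n+1)/2 is the last one in the expansion of X^{n+1}, so this is the telescoped value
at 1 of that expansion. -/
theorem legendreExpansionCoeff_half (n : ℕ) :
    legendreExpansionCoeff n ((n + 1) / 2) = 1 / (n + 1).factorial := by
  have f : ∀ k : ℕ, (k.factorial : ℂ) ≠ 0 := fun k => by exact_mod_cast k.factorial_ne_zero
  unfold legendreExpansionCoeff
  obtain ⟨r, rfl | rfl⟩ := Nat.even_or_odd' n
  · rw [show (2 * r + 1) / 2 = r by omega, show 2 * r - r = r by omega,
      show 2 * (2 * r) - 2 * r + 1 = 2 * r + 1 by omega, pow_mul]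
    have := f r
    have := f (2 * r + 1)
    norm_num
    field_simp
  · rw [show (2 * r + 1 + 1) / 2 = r + 1 by omega, show 2 * r + 1 - (r + 1) = r by omega,
      show 2 * (2 * r + 1) - 2 * (r + 1) + 1 = 2 * r + 1 by omega, pow_succ, pow_succ, pow_mul,
      Nat.factorial_succ r, Nat.factorial_succ (2 * r + 1)]
    have := f r
    have := f (2 * r + 1)
    have h1 : (r : ℂ) + 1 ≠ 0 := Nat.cast_add_one_ne_zero r
    have h2 : ((2 * r + 1 : ℕ) : ℂ) + 1 ≠ 0 := Nat.cast_add_one_ne_zero _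
    push_cast at h2 ⊢
    norm_num
    field_simp
    ring

theorem sum_legendreExpansionCoeff (n K : ℕ) (hK : K ≤ n) :
    ∑ k ∈ Finset.range (K + 1),
      legendreExpansionCoeff (n + 1) k * (2 * ((n : ℂ) + 1 - 2 * k) + 1) =
        legendreExpansionCoeff n K := by
  induction K with
  | zero =>
    have := legendreExpansionCoeff_zero n
    push_cast at this
    simpa using this
  | succ K ih =>
    rw [Finset.sum_range_succ, ih (by omega)]
    have := legendreExpansionCoeff_succ hK
    push_cast
    linear_combination this

/-- Abel summation, meant for q k = P'_{n+1-2k}, whose differences are multiples of Legendre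
polynomials. -/
theorem sum_legendreExpansionCoeff_mul_sub (n K : ℕ) (hK : K ≤ n) (q : ℕ → ℂ[X]) :
    ∑ k ∈ Finset.range (K + 1),
      C (legendreExpansionCoeff (n + 1) k * (2 * ((n : ℂ) + 1 - 2 * k) + 1)) * q k =
        ∑ k ∈ Finset.range (K + 1), C (legendreExpansionCoeff n k) * (q k - q (k + 1)) +
          C (legendreExpansionCoeff n K) * q (K + 1) := by
  induction K with
  | zero =>
    have := legendreExpansionCoeff_zero n
    push_cast at this
    simp only [zero_add, Finset.sum_range_one, Nat.cast_zero, mul_zero, sub_zero]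
    rw [this]
    ring
  | succ K ih =>
    rw [Finset.sum_range_succ, ih (by omega), Finset.sum_range_succ _ (K + 1)]
    have := legendreExpansionCoeff_succ hK
    push_cast
    rw [this, C_sub]
    ring

theorem legendrePoly_mul_eq_sub {n k : ℕ} (h : 2 * k ≤ n) :
    C (2 * ((n : ℂ) - 2 * k) + 1) * legendrePoly (n - 2 * k) =
      derivative (legendrePoly (n + 1 - 2 * k)) -
        derivative (legendrePoly (n + 1 - 2 * (k + 1))) := by
  have := derivative_legendrePoly_succ (n - 2 * k)
  rw [show n + 1 - 2 * k = n - 2 * k + 1 by omega, this,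
    show n + 1 - 2 * (k + 1) = n - 2 * k - 1 by omega, Nat.cast_sub h]
  push_cast
  ring

/-- The expansion of a monomial in Legendre polynomials. -/
theorem sum_legendreExpansionCoeff_mul_legendrePoly (n : ℕ) :
    ∑ k ∈ Finset.range (n / 2 + 1),
      C (legendreExpansionCoeff n k * (2 * ((n : ℂ) - 2 * k) + 1)) * legendrePoly (n - 2 * k) =
        C (1 / (n.factorial : ℂ)) * X ^ n := by
  have h0 : legendrePoly 0 = 1 := by simp [legendrePoly]
  induction n with
  | zero => simp [h0, legendreExpansionCoeff]
  | succ n ih =>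
    have hc : ∀ k : ℕ, (2 * (((n + 1 : ℕ) : ℂ) - 2 * k) + 1) = 2 * ((n : ℂ) + 1 - 2 * k) + 1 := by
      intro k
      push_cast
      ring
    simp only [hc]
    refine eq_of_derivative_eq_of_eval_eq (a := 1) ?_ ?_
    · have hq : derivative (legendrePoly (n + 1 - 2 * (n / 2 + 1))) = 0 := by
        rw [show n + 1 - 2 * (n / 2 + 1) = 0 by omega, h0, derivative_one]
      -- For odd n the left sum has one more term, which contains the derivative of the constant
      -- P_0.
      have e : ∑ k ∈ Finset.range ((n + 1) / 2 + 1),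
          C (legendreExpansionCoeff (n + 1) k * (2 * ((n : ℂ) + 1 - 2 * k) + 1)) *
            derivative (legendrePoly (n + 1 - 2 * k)) = ∑ k ∈ Finset.range (n / 2 + 1),
          C (legendreExpansionCoeff (n + 1) k * (2 * ((n : ℂ) + 1 - 2 * k) + 1)) *
            derivative (legendrePoly (n + 1 - 2 * k)) := by
        rcases (by omega : (n + 1) / 2 = n / 2 ∨ (n + 1) / 2 = n / 2 + 1) with h | h
        · rw [h]
        · rw [h, Finset.sum_range_succ _ (n / 2 + 1), hq, mul_zero, add_zero]
      simp only [derivative_sum, derivative_C_mul]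
      rw [e, sum_legendreExpansionCoeff_mul_sub n (n / 2) (by omega)
        (fun k => derivative (legendrePoly (n + 1 - 2 * k))), hq, mul_zero, add_zero,
        derivative_X_pow]
      have f : ((n : ℂ) + 1) ≠ 0 := Nat.cast_add_one_ne_zero n
      have f' : (n.factorial : ℂ) ≠ 0 := by exact_mod_cast n.factorial_ne_zero
      rw [← mul_assoc, ← C_mul, Nat.factorial_succ, Nat.add_sub_cancel]
      have : 1 / (((n + 1) * n.factorial : ℕ) : ℂ) * ((n + 1 : ℕ) : ℂ) = 1 / n.factorial := by
        push_cast
        field_simp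
      rw [this, ← ih]
      refine Finset.sum_congr rfl fun k hk => ?_
      rw [Finset.mem_range] at hk
      rw [C_mul, mul_assoc, legendrePoly_mul_eq_sub (by omega)]
    · simp only [eval_finsetSum, eval_mul, eval_C, legendrePoly_eval_one, mul_one, eval_pow, eval_X,
        one_pow]
      rw [sum_legendreExpansionCoeff n _ (by omega), legendreExpansionCoeff_half]

theorem sum_legendreExpansionCoeff_mul_iterate_derivative {n m : ℕ} (h : m ≤ n) :
    ∑ k ∈ Finset.range ((n - m) / 2 + 1),
      C (legendreExpansionCoeff n k * (2 * ((n : ℂ) - 2 * k) + 1)) *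
        derivative^[m] (legendrePoly (n - 2 * k)) =
        C (1 / ((n - m).factorial : ℂ)) * X ^ (n - m) := by
  have e := congrArg (derivative^[m]) (sum_legendreExpansionCoeff_mul_legendrePoly n)
  rw [iterate_derivative_sum, iterate_derivative_C_mul, iterate_derivative_X_pow_eq_C_mul,
    ← mul_assoc, ← C_mul] at e
  have f : ((n - m).factorial : ℂ) ≠ 0 := by exact_mod_cast (n - m).factorial_ne_zero
  have f' : (n.factorial : ℂ) ≠ 0 := by exact_mod_cast n.factorial_ne_zero
  have : 1 / (n.factorial : ℂ) * (n.descFactorial m : ℂ) = 1 / ((n - m).factorial : ℂ) := by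
    have := Nat.factorial_mul_descFactorial h
    rw [← this]
    push_cast
    have f'' : (n.descFactorial m : ℂ) ≠ 0 := by
      rw [← this] at f'
      push_cast at f'
      exact (mul_ne_zero_iff.1 f').2
    field_simp
  rw [this] at e
  rw [← e]
  simp only [iterate_derivative_C_mul]
  -- The indices dropped have n - 2k < m, so the m-th derivative kills those polynomials.
  refine Finset.sum_subset (by
    intro k
    simp only [Finset.mem_range]
    omega) fun k hk hk' => ?_
  rw [Finset.mem_range] at hk hk'
  rw [iterate_derivative_eq_zero, mul_zero]
  have hdeg : (legendrePoly (n - 2 * k)).natDegree ≤ n - 2 * k := by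
    refine (natDegree_C_mul_le _ _).trans ((natDegree_iterate_derivative _ _).trans ?_)
    have : ((X ^ 2 - 1 : ℂ[X]) ^ (n - 2 * k)).natDegree ≤ (n - 2 * k) * 2 := by
      refine natDegree_pow_le_of_le _ ?_
      compute_degree
    omega
  omega

/-! ### The functions U as axial extensions -/

/-- The axial extension of `f`, at radius `ρ`, as a polynomial in `x₀`. -/
noncomputable def axialSlice (m : ℕ) (w : ℂ) (f : ℂ[X]) : ℂ[X] :=
  (axialExtension m f).eval (C w)

theorem derivative_axialSlice (m : ℕ) (w : ℂ) (f : ℂ[X]) :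
    derivative (axialSlice m w f) = axialSlice m w (derivative f) := by
  rw [axialSlice, axialSlice, axialExtension_derivative]
  generalize axialExtension m f = h
  induction h using Polynomial.induction_on' with
  | add g h hg hh => rw [eval_add, derivative_add, hg, hh, innerDerivative_add, eval_add]
  | monomial i f =>
    rw [innerDerivative_monomial, eval_monomial, eval_monomial, ← C_pow, mul_comm,
      derivative_C_mul, mul_comm]

theorem axialSlice_C_mul (m : ℕ) (w c : ℂ) (f : ℂ[X]) :
    axialSlice m w (C c * f) = C c * axialSlice m w f := by
  rw [axialSlice, axialExtension_C_mul, eval_mul, eval_C, axialSlice]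

theorem axialSlice_sum (m : ℕ) (w : ℂ) {ι : Type*} (s : Finset ι) (c : ι → ℂ) (f : ι → ℂ[X]) :
    axialSlice m w (∑ k ∈ s, C (c k) * f k) = ∑ k ∈ s, C (c k) * axialSlice m w (f k) := by
  simp only [axialSlice, axialExtension_sum, eval_finsetSum, eval_mul, eval_C]

/-- Homogeneity of the axial extension of a monomial. -/
theorem eval_axialSlice_X_pow (m N : ℕ) (c w x : ℂ) :
    (axialSlice m (c ^ 2 * w) (X ^ N)).eval (c * x) = c ^ N * (axialSlice m w (X ^ N)).eval x := by
  simp only [axialSlice, axialExtension, eval_finsetSum, eval_monomial,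
    iterate_derivative_X_pow_eq_C_mul, eval_mul, eval_C, eval_pow, eval_X, Finset.mul_sum]
  refine Finset.sum_congr rfl fun i _ => ?_
  rcases le_or_gt (2 * i) N with h | h
  · obtain ⟨r, rfl⟩ := Nat.exists_eq_add_of_le h
    rw [Nat.add_sub_cancel_left]
    ring
  · rw [Nat.descFactorial_of_lt h]
    simp

/-- With a = cos u and b = cosh v, the separation formula sits at b a = x₀/μ and (b² - 1)(1 - a²) =
(ρ/μ)², while the factors sin u sinh v give ρ/μ. For fixed ρ this is a polynomial in x₀, so
differentiability needs no regularity of the coordinates, even at the foci. -/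
theorem meridionalU_eq_axialSlice {μ : ℂ} (hμ : μ ∈ spheroidalParams) (h0 : μ ≠ 0) {n m : ℕ}
    (hmn : m ≤ n) (x₀ : ℝ) {ρ : ℝ} (hρ : 0 ≤ ρ) :
    meridionalU μ n m x₀ ρ =
      (n + m).factorial / (2 ^ m * (2 ^ n * (ascPochhammer ℂ n).eval (1 / 2))) * (-(ρ : ℂ)) ^ m *
        μ ^ (n - m) *
        (axialSlice m ((ρ / μ) ^ 2) (derivative^[m] (legendrePoly n))).eval (x₀ / μ) := by
  obtain ⟨⟨u, v⟩, h⟩ := exists_isSpheroidalCoord hμ h0 x₀ hρ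
  rw [meridionalU_eq hμ h0 n m h]
  obtain ⟨hu0, hu1, -, -, hx, hr⟩ := h
  have hs : Real.sqrt (1 - Real.cos u ^ 2) = Real.sin u := by
    rw [← Real.sin_sq, Real.sqrt_sq (Real.sin_nonneg_of_nonneg_of_le_pi hu0 hu1)]
  have e1 : (x₀ : ℂ) / μ = Complex.cosh v * Complex.cos u := by
    rw [hx]
    field_simp
  have e2 : ((ρ : ℂ) / μ) ^ 2 = (Complex.cosh v ^ 2 - 1) * (1 - Complex.cos u ^ 2) := by
    rw [← Complex.sin_sq, ← Complex.sinh_sq, hr]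
    field_simp
  have key := legendrePoly_mul_legendrePoly hmn (Complex.cos u) (Complex.cosh v)
  rw [eval_spheroidalSubst, ← e1, ← e2] at key
  have f2 : ((n - m).factorial : ℂ) ≠ 0 := by exact_mod_cast (n - m).factorial_ne_zero
  simp only [spheroidalProduct, assocLegendreCut, assocLegendreCosh, hs, Complex.ofReal_sin,
    Complex.ofReal_cos]
  have eμ : μ ^ n = μ ^ m * μ ^ (n - m) := by rw [← pow_add, Nat.add_sub_cancel' hmn]
  have er : (-(ρ : ℂ)) ^ m = (-1) ^ m * μ ^ m * Complex.sin u ^ m * Complex.sinh v ^ m := by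
    rw [← mul_pow, ← mul_pow, ← mul_pow, hr]
    ring
  rw [axialSlice, eμ, er]
  calc _ = ((n - m).factorial : ℂ) / (2 ^ n * (ascPochhammer ℂ n).eval (1 / 2)) * μ ^ m *
        μ ^ (n - m) * (-1) ^ m * Complex.sin u ^ m * Complex.sinh v ^ m *
        ((derivative^[m] (legendrePoly n)).eval (Complex.cos u) *
          (derivative^[m] (legendrePoly n)).eval (Complex.cosh v)) := by ring
    _ = _ := by
      rw [key, div_mul_eq_div_div, div_mul_eq_div_div]
      field_simp

theorem meridionalU_zero_eq_axialSlice {n m : ℕ} (hmn : m ≤ n) (x₀ : ℝ) {ρ : ℝ} (hρ : 0 ≤ ρ) :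
    meridionalU 0 n m x₀ ρ =
      (n + m).factorial / 2 ^ m * (-(ρ : ℂ)) ^ m *
        (axialSlice m ((ρ : ℂ) ^ 2) (C (1 / ((n - m).factorial : ℂ)) * X ^ (n - m))).eval
          (x₀ : ℂ) := by
  rw [meridionalU, if_pos rfl]
  set r := Real.sqrt (x₀ ^ 2 + ρ ^ 2) with hr
  have hr2 : r ^ 2 = x₀ ^ 2 + ρ ^ 2 := Real.sq_sqrt (by positivity)
  have hr0 : 0 ≤ r := Real.sqrt_nonneg _
  set t := x₀ / r with ht
  -- At the origin t = 0 by the convention for division by zero, and the relation still holds.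
  have hx : x₀ = r * t := by
    rcases hr0.eq_or_lt with h | h
    · rw [← h] at hr2 ⊢
      nlinarith
    · rw [ht]
      field_simp
  have hρ2 : ρ ^ 2 = r ^ 2 * (1 - t ^ 2) := by
    have := congrArg (· ^ 2) hx
    simp only [mul_pow] at this
    linarith
  have hρ1 : ρ = r * Real.sqrt (1 - t ^ 2) := by
    rw [← Real.sqrt_sq hρ, hρ2, Real.sqrt_mul (sq_nonneg r), Real.sqrt_sq hr0]
  have hw : (ρ : ℂ) ^ 2 = (r : ℂ) ^ 2 * (1 * (1 - (t : ℂ) ^ 2)) := by exact_mod_cast (by rw [hρ2]; ring)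
  rw [hw, axialSlice_C_mul, eval_mul, eval_C, hx, Complex.ofReal_mul, eval_axialSlice_X_pow,
    assocLegendreCut, eval_iterate_derivative_legendrePoly hmn, eval_spheroidalSubst, one_mul,
    axialExtension_C_mul, eval_mul, eval_C, eval_mul, eval_C, ← axialSlice, hρ1]
  have e : (r : ℂ) ^ n = (r : ℂ) ^ m * (r : ℂ) ^ (n - m) := by
    rw [← pow_add, Nat.add_sub_cancel' hmn]
  rw [e, Complex.ofReal_mul, neg_pow ((r : ℂ) * _), mul_pow]
  ring

/-! ### Derivatives in the axial direction -/

theorem hasDerivAt_eval_ofReal_div (f : ℂ[X]) (μ : ℂ) (x : ℝ) :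
    HasDerivAt (fun t : ℝ => f.eval ((t : ℂ) / μ)) ((derivative f).eval ((x : ℂ) / μ) / μ) x := by
  have h := (f.hasDerivAt ((x : ℂ) / μ)).comp (x : ℂ) ((hasDerivAt_id (x : ℂ)).div_const μ)
  simpa [div_eq_mul_inv] using h.comp_ofReal

/-- The derivative passes to the axis polynomial, and the chain-rule factor 1/μ lowers μ^{n+1-m} to
μ^{n-m}. -/
theorem hasDerivAt_meridionalU {μ : ℂ} (hμ : μ ∈ spheroidalParams) (h0 : μ ≠ 0) {n m : ℕ}
    (hmn : m ≤ n) (x₀ : ℝ) {ρ : ℝ} (hρ : 0 ≤ ρ) :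
    HasDerivAt (fun t : ℝ => meridionalU μ (n + 1) m t ρ)
      ((n + 1 + m).factorial /
        (2 ^ m * (2 ^ (n + 1) * (ascPochhammer ℂ (n + 1)).eval (1 / 2))) * (-(ρ : ℂ)) ^ m *
        μ ^ (n - m) *
        (axialSlice m ((ρ / μ) ^ 2) (derivative^[m + 1] (legendrePoly (n + 1)))).eval
          (x₀ / μ)) x₀ := by
  have e : (fun t : ℝ => meridionalU μ (n + 1) m t ρ) = _ :=
    funext fun t => meridionalU_eq_axialSlice hμ h0 (hmn.trans n.le_succ) t hρ
  rw [e]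
  refine ((hasDerivAt_eval_ofReal_div (axialSlice m ((ρ / μ) ^ 2)
    (derivative^[m] (legendrePoly (n + 1)))) μ x₀).const_mul _).congr_deriv ?_
  rw [derivative_axialSlice, ← Function.iterate_succ_apply' (f := derivative),
    show n + 1 - m = n - m + 1 by omega, pow_succ μ]
  field_simp

/-- The normalized monomial x^{n+1-m}/(n+1-m)! differentiates to x^{n-m}/(n-m)!; the factor n + m +
1 is the quotient of the prefactors (n+1+m)! and (n+m)!. -/
theorem hasDerivAt_meridionalU_zero {n m : ℕ} (hmn : m ≤ n) (x₀ : ℝ) {ρ : ℝ} (hρ : 0 ≤ ρ) :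
    HasDerivAt (fun t : ℝ => meridionalU 0 (n + 1) m t ρ)
      ((n + m + 1) * meridionalU 0 n m x₀ ρ) x₀ := by
  have e : (fun t : ℝ => meridionalU 0 (n + 1) m t ρ) = _ :=
    funext fun t => meridionalU_zero_eq_axialSlice (hmn.trans n.le_succ) t hρ
  rw [e, meridionalU_zero_eq_axialSlice hmn x₀ hρ]
  have h := (hasDerivAt_eval_ofReal_div (axialSlice m ((ρ : ℂ) ^ 2)
    (C (1 / ((n + 1 - m).factorial : ℂ)) * X ^ (n + 1 - m))) 1 x₀).const_mul
      ((n + 1 + m).factorial / 2 ^ m * (-(ρ : ℂ)) ^ m)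
  simp only [div_one] at h
  refine h.congr_deriv ?_
  have f2 : ((n - m).factorial : ℂ) ≠ 0 := by exact_mod_cast (n - m).factorial_ne_zero
  have f1 : ((n - m : ℕ) : ℂ) + 1 ≠ 0 := Nat.cast_add_one_ne_zero _
  rw [derivative_axialSlice, show n + 1 - m = n - m + 1 by omega, derivative_C_mul,
    derivative_X_pow, Nat.add_sub_cancel, ← mul_assoc, ← C_mul, Nat.factorial_succ (n - m),
    show n + 1 + m = n + m + 1 by ring, Nat.factorial_succ (n + m)]
  have : 1 / (((n - m + 1) * (n - m).factorial : ℕ) : ℂ) * ((n - m + 1 : ℕ) : ℂ) =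
      1 / (n - m).factorial := by
    push_cast
    field_simp
  rw [this]
  push_cast
  ring

theorem differentiableAt_meridionalU {μ : ℂ} (hμ : μ ∈ spheroidalParams) {n m : ℕ}
    (hmn : m ≤ n) (x₀ : ℝ) {ρ : ℝ} (hρ : 0 ≤ ρ) :
    DifferentiableAt ℝ (fun t : ℝ => meridionalU μ (n + 1) m t ρ) x₀ := by
  by_cases h0 : μ = 0
  · subst h0
    exact (hasDerivAt_meridionalU_zero hmn x₀ hρ).differentiableAt
  · exact (hasDerivAt_meridionalU hμ h0 hmn x₀ hρ).differentiableAt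

theorem lineDifferentiableAt_solidU {μ : ℂ} (hμ : μ ∈ spheroidalParams) {n m : ℕ}
    (hmn : m ≤ n) (s : HarmonicSign) (x : EuclideanSpace ℝ (Fin 3)) :
    LineDifferentiableAt ℝ (solidU μ (n + 1) m s) x (EuclideanSpace.single 0 1) := by
  have h : (fun t : ℝ => solidU μ (n + 1) m s (x + t • EuclideanSpace.single 0 1)) =
      fun t : ℝ => meridionalU μ (n + 1) m (x 0 + t) (axialRadius x) *
        (angularFactor s m (azimuth x) : ℂ) := by
    funext t
    simp [solidU, axialRadius, azimuth]
  unfold LineDifferentiableAt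
  rw [h]
  have hd : DifferentiableAt ℝ (fun t : ℝ => meridionalU μ (n + 1) m t (axialRadius x)) (x 0 + 0) :=
    differentiableAt_meridionalU hμ hmn _ (Real.sqrt_nonneg _)
  exact (DifferentiableAt.comp (0 : ℝ) hd
    ((differentiableAt_const (x 0)).add differentiableAt_id)).mul_const _

/-! ### Matching the coefficients and conclusion -/

theorem ascPochhammer_eval_half_ne_zero (n : ℕ) : (ascPochhammer ℚ n).eval (1 / 2) ≠ 0 :=
  (ascPochhammer_pos n (1 / 2 : ℚ) (by norm_num)).ne'

theorem ascPochhammer_eval_half_cast (n : ℕ) :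
    (((ascPochhammer ℚ n).eval (1 / 2) : ℚ) : ℂ) = (ascPochhammer ℂ n).eval (1 / 2) := by
  have h := ascPochhammer_eval₂ (algebraMap ℚ ℂ) n (1 / 2)
  rw [h, show (1 / 2 : ℂ) = algebraMap ℚ ℂ (1 / 2) by simp, eval₂_hom, eq_ratCast]

theorem ascPochhammer_eval_half (n : ℕ) :
    4 ^ n * (n.factorial : ℚ) * (ascPochhammer ℚ n).eval (1 / 2) = (2 * n).factorial := by
  induction n with
  | zero => simp
  | succ n ih =>
    rw [ascPochhammer_succ_eval, show 2 * (n + 1) = 2 * n + 1 + 1 by ring, Nat.factorial_succ,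
      Nat.factorial_succ, Nat.factorial_succ]
    push_cast
    rw [← ih]
    ring

theorem coeffUV_zero_mul (n m : ℕ) : coeffUV n m 0 * ((n : ℚ) + m + 1) = 1 := by
  have f : ∀ k : ℕ, (k.factorial : ℚ) ≠ 0 := fun k => by exact_mod_cast k.factorial_ne_zero
  have f1 := f (n + 1 + m)
  have f2 := f (2 * (n + 1))
  have g : (n : ℚ) + m + 1 ≠ 0 := by positivity
  have g' : 2 * ((n : ℚ) + 1) + 1 ≠ 0 := by positivity
  have h := ascPochhammer_eval_half (n + 1)
  rw [coeffUV, div_mul_cancel₀ _ g, coeffUU]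
  simp only [mul_zero, Nat.sub_zero, Nat.factorial_zero, Nat.cast_zero, sub_zero, Nat.cast_one]
  rw [add_comm m (n + 1), Nat.factorial_succ (2 * (n + 1))]
  push_cast
  rw [div_eq_one_iff_eq (by simp [f1, f2, g'])]
  linear_combination (2 * ((n : ℚ) + 1) + 1) * ((n + 1 + m).factorial : ℚ) * h

/-- Here the given coefficients meet the normalization of V: the half-integer Pochhammer symbols
cancel and leave a Legendre coefficient of degree n + 1, because V_{n,m} is a derivative of
U_{n+1,m}. -/
theorem coeffUV_eq {n m k : ℕ} (h : 2 * k ≤ n - m) (hmn : m ≤ n) :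
    (coeffUV n m k : ℂ) * ((n - 2 * k + 1 + m).factorial /
        (2 ^ m * (2 ^ (n - 2 * k + 1) * (ascPochhammer ℂ (n - 2 * k + 1)).eval (1 / 2)))) =
      (n + m).factorial / 2 ^ m * (legendreExpansionCoeff (n + 1) k *
        (2 * (((n + 1 : ℕ) : ℂ) - 2 * k) + 1)) := by
  have hp : (ascPochhammer ℂ (n - 2 * k + 1)).eval (1 / 2) ≠ 0 := by
    rw [← ascPochhammer_eval_half_cast]
    exact_mod_cast ascPochhammer_eval_half_ne_zero _
  have f : ∀ k : ℕ, (k.factorial : ℂ) ≠ 0 := fun k => by exact_mod_cast k.factorial_ne_zero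
  obtain ⟨j, rfl⟩ := Nat.exists_eq_add_of_le (h.trans (Nat.sub_le n m))
  rw [coeffUV, coeffUU, legendreExpansionCoeff]
  rw [show 2 * k + j + 1 - 2 * k = j + 1 by omega, show 2 * k + j - 2 * k = j by omega] at *
  rw [show 2 * k + j + 1 + m - 2 * k = j + 1 + m by omega,
    show m + (2 * k + j + 1) = 2 * k + j + m + 1 by ring, Nat.factorial_succ (2 * k + j + m)]
  push_cast
  rw [ascPochhammer_eval_half_cast]
  have g : ((2 * k + j + m : ℕ) : ℂ) + 1 ≠ 0 := Nat.cast_add_one_ne_zero _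
  push_cast at g
  have f1 := f k
  have f2 := f (j + 1 + m)
  have f3 := f (2 * (2 * k + j + 1) - 2 * k + 1)
  rw [show (4 : ℂ) = 2 ^ 2 by norm_num, ← pow_mul, ← pow_mul]
  field_simp
  ring

theorem meridionalV_expansion {n m : ℕ} (hmn : m ≤ n) {μ : ℂ} (hμ : μ ∈ spheroidalParams)
    (x₀ : ℝ) {ρ : ℝ} (hρ : 0 ≤ ρ) :
    meridionalU 0 n m x₀ ρ =
      ∑ k ∈ Finset.range ((n - m) / 2 + 1),
        (coeffUV n m k : ℂ) * μ ^ (2 * k) * meridionalV μ (n - 2 * k) m x₀ ρ := by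
  by_cases h0 : μ = 0
  · subst h0
    -- For μ = 0 only k = 0 survives, with 0^0 = 1.
    rw [Finset.sum_range_succ', Finset.sum_eq_zero, zero_add]
    · rw [meridionalV, (hasDerivAt_meridionalU_zero (n := n - 2 * 0) hmn x₀ hρ).deriv]
      have e : (coeffUV n m 0 : ℂ) * ((n : ℂ) + m + 1) = 1 := by
        exact_mod_cast coeffUV_zero_mul n m
      simp only [mul_zero, Nat.sub_zero, pow_zero, mul_one]
      rw [← mul_assoc, e, one_mul]
    · intro k _
      rw [zero_pow (by omega)]
      ring
  · have hsum : ∀ k ∈ Finset.range ((n - m) / 2 + 1),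
        (coeffUV n m k : ℂ) * μ ^ (2 * k) * meridionalV μ (n - 2 * k) m x₀ ρ =
        (n + m).factorial / 2 ^ m * (-(ρ : ℂ)) ^ m * μ ^ (n - m) *
          ((legendreExpansionCoeff (n + 1) k * (2 * (((n + 1 : ℕ) : ℂ) - 2 * k) + 1)) *
          (axialSlice m ((ρ / μ) ^ 2)
            (derivative^[m + 1] (legendrePoly (n + 1 - 2 * k)))).eval (x₀ / μ)) := by
      intro k hk
      rw [Finset.mem_range] at hk
      have hk' : 2 * k ≤ n - m := by omega
      rw [meridionalV, (hasDerivAt_meridionalU hμ h0 (by omega) x₀ hρ).deriv,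
        show n + 1 - 2 * k = n - 2 * k + 1 by omega]
      have e : μ ^ (n - m) = μ ^ (2 * k) * μ ^ (n - 2 * k - m) := by
        rw [← pow_add]
        congr 1
        omega
      rw [e]
      linear_combination (μ ^ (2 * k) * (-(ρ : ℂ)) ^ m * μ ^ (n - 2 * k - m) *
        (axialSlice m ((ρ / μ) ^ 2)
            (derivative^[m + 1] (legendrePoly (n - 2 * k + 1)))).eval (x₀ / μ)) * coeffUV_eq hk' hmn
    -- The Legendre expansion is used with n + 1 and m + 1, so its right-hand side is the monomial
    -- of degree n - m that defines U_{n,m}[0].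
    have hE := congrArg (fun f => (axialSlice m ((ρ / μ) ^ 2) f).eval ((x₀ : ℂ) / μ))
      (sum_legendreExpansionCoeff_mul_iterate_derivative (Nat.succ_le_succ hmn))
    simp only [axialSlice_sum, eval_finsetSum, eval_mul, eval_C, Nat.succ_eq_add_one,
      Nat.add_sub_add_right] at hE
    rw [Finset.sum_congr rfl hsum, ← Finset.mul_sum, hE, meridionalU_zero_eq_axialSlice hmn x₀ hρ,
      axialSlice_C_mul, axialSlice_C_mul, eval_mul, eval_mul, eval_C, eval_C]
    -- Scaling by μ absorbs the common factor μ^{n-m} and returns from (x₀/μ, (ρ/μ)²) to (x₀, ρ²).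
    have hh := eval_axialSlice_X_pow m (n - m) μ ((ρ / μ) ^ 2) (x₀ / μ)
    rw [show μ ^ 2 * ((ρ : ℂ) / μ) ^ 2 = (ρ : ℂ) ^ 2 by field_simp, mul_div_cancel₀ _ h0] at hh
    rw [hh]
    ring

theorem mainTheorem8 (n m : ℕ) (hmn : m ≤ n) (μ : ℂ) (hμ : μ ∈ spheroidalParams) :
    (∀ k ∈ Finset.range ((n - m) / 2 + 1), ∀ (s : HarmonicSign) (x : EuclideanSpace ℝ (Fin 3)),
      LineDifferentiableAt ℝ (solidU μ (n - 2 * k + 1) m s) x (EuclideanSpace.single 0 1)) ∧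
    (∀ (s : HarmonicSign) (x : EuclideanSpace ℝ (Fin 3)),
      solidU 0 n m s x =
        ∑ k ∈ Finset.range ((n - m) / 2 + 1),
          (coeffUV n m k : ℂ) * μ ^ (2 * k) * solidV μ (n - 2 * k) m s x) ∧
    (∀ x₀ ρ : ℝ, 0 ≤ ρ →
      meridionalU 0 n m x₀ ρ =
        ∑ k ∈ Finset.range ((n - m) / 2 + 1),
          (coeffUV n m k : ℂ) * μ ^ (2 * k) * meridionalV μ (n - 2 * k) m x₀ ρ) := by
  refine ⟨fun k hk s x => ?_, fun s x => ?_, fun x₀ ρ hρ => meridionalV_expansion hmn hμ x₀ hρ⟩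
  · rw [Finset.mem_range] at hk
    exact lineDifferentiableAt_solidU hμ (by omega) s x
  · rw [solidU, meridionalV_expansion hmn hμ _ (show 0 ≤ axialRadius x from Real.sqrt_nonneg _),
      Finset.sum_mul]
    refine Finset.sum_congr rfl fun k _ => ?_
    rw [solidV_eq]
    ring
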